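/- Let $L$ be a unital $C^*$-algebra and let $A \subseteq L$ be a norm-closed two-sided $*$-ideal. Put $D(L,A) := \{(x,y) \in L \oplus L \mid x - y \in A\}$, a unital $C^*$-subalgebra of $L \oplus L$, with the unital $*$-homomorphisms $\rho_1 : D(L,A) \to L$, $\rho_1(x,y) = x$, and $\Delta : L \to D(L,A)$, $\Delta(x) = (x,x)$, applied entrywise to matrices. Let $E_n$ be the unit of $M_n(D(L,A))$. The relative $K$-group is $$K_0(L,A) := \ker\big( K_0(\rho_1) : K_0(D(L,A)) \to K_0(L) \big).$$ Let $W_n(L,A)$ be the set of selfadjoint invertible elements of $M_n(D(L,A))$ with the norm topology. Call $H_0 \in W_n(L,A)$ and $H_1 \in W_m(L,A)$ stably homotopic if there are $k \geq n,m$ and selfadjoint invertible elements $G_0 \in M_{k-n}(L)$, $G_1 \in M_{k-m}(L)$ such that $H_0 \oplus \Delta(G_0)$ and $H_1 \oplus \Delta(G_1)$ are joined by a continuous path in $W_k(L,A)$. Let $K_0^{\mathrm{inv}}(L,A)$ be the set of stable homotopy classes in $\bigsqcup_n W_n(L,A)$, which is an abelian group with addition $[H] + [H'] = [H \oplus H']$,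 neutral element $[E_1]$ and inverses $-[H] = [-H]$. For $H \in W_n(L,A)$ let $H_+ := \frac{1}{2}\big(E_n + H |H|^{-1}\big)$, a projection in $M_n(D(L,A))$. Then there is an isomorphism of abelian groups $\varphi : K_0^{\mathrm{inv}}(L,A) \to K_0(L,A)$ such that, for every $n$ and every $H \in W_n(L,A)$, $$\varphi([H]) = [H_+] - [(\Delta \rho_1)(H_+)],$$ and such that, for all projections $p \in M_n(D(L,A))$ and $q \in M_m(D(L,A))$ with $[p] - [q] \in K_0(L,A)$, $$\varphi^{-1}([p] - [q]) = \big[(2p - E_n) \oplus (E_m - 2q)\big].$$ -/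

import Mathlib

noncomputable section

namespace RelK

/-! ### Matrices over a unital C*-algebra and their direct sums -/

/-- The matrix algebra `M_n(B)`, with its C*-norm topology. -/
abbrev Mat (B : Type*) (n : ℕ) : Type _ := CStarMatrix (Fin n) (Fin n) B

section Matrices

open scoped CStarAlgebra

variable {B C : Type*} [CStarAlgebra B] [CStarAlgebra C]

theorem reindex_apply {n m : Type*} [Fintype n] [Fintype m] (e : n ≃ m)
    (X : CStarMatrix n n B) (i j : m) :
    CStarMatrix.reindexₐ ℂ B e X i j = X (e.symm i) (e.symm j) := rfl

/-- The direct sum `X ⊕ Y` of square matrices (block diagonal matrix). -/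
def dsum {n m : ℕ} (X : Mat B n) (Y : Mat B m) : Mat B (n + m) :=
  CStarMatrix.reindexₐ ℂ B finSumFinEquiv (CStarMatrix.ofMatrix
    (Matrix.fromBlocks (CStarMatrix.ofMatrix.symm X) 0 0 (CStarMatrix.ofMatrix.symm Y)))

theorem dsum_apply {n m : ℕ} (X : Mat B n) (Y : Mat B m) (i j : Fin n ⊕ Fin m) :
    dsum X Y (finSumFinEquiv i) (finSumFinEquiv j) =
      Matrix.fromBlocks (CStarMatrix.ofMatrix.symm X) 0 0 (CStarMatrix.ofMatrix.symm Y) i j := by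
  rw [dsum, reindex_apply, Equiv.symm_apply_apply, Equiv.symm_apply_apply]
  rfl

theorem mat_ext_sum {R : Type*} {n m : ℕ} {X Y : Mat R (n + m)}
    (h : ∀ i j : Fin n ⊕ Fin m, X (finSumFinEquiv i) (finSumFinEquiv j) =
      Y (finSumFinEquiv i) (finSumFinEquiv j)) : X = Y := by
  ext i j
  simpa using h (finSumFinEquiv.symm i) (finSumFinEquiv.symm j)

theorem dsum_mul {n m : ℕ} (X X' : Mat B n) (Y Y' : Mat B m) :
    dsum X Y * dsum X' Y' = dsum (X * X') (Y * Y') := by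
  unfold dsum
  rw [← map_mul]
  congr 1
  have := Matrix.fromBlocks_multiply (CStarMatrix.ofMatrix.symm X) 0 0
    (CStarMatrix.ofMatrix.symm Y) (CStarMatrix.ofMatrix.symm X') 0 0 (CStarMatrix.ofMatrix.symm Y')
  simp only [Matrix.mul_zero, Matrix.zero_mul, add_zero, zero_add] at this
  exact this

theorem dsum_star {n m : ℕ} (X : Mat B n) (Y : Mat B m) :
    star (dsum X Y) = dsum (star X) (star Y) := by
  unfold dsum
  rw [← map_star]
  congr 1
  have := Matrix.fromBlocks_conjTranspose (CStarMatrix.ofMatrix.symm X) 0 0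
    (CStarMatrix.ofMatrix.symm Y)
  simp only [Matrix.conjTranspose_zero] at this
  exact this

theorem dsum_one {n m : ℕ} : dsum (1 : Mat B n) (1 : Mat B m) = 1 := by
  unfold dsum
  have : (CStarMatrix.ofMatrix (Matrix.fromBlocks (CStarMatrix.ofMatrix.symm (1 : Mat B n)) 0 0
    (CStarMatrix.ofMatrix.symm (1 : Mat B m)))) = 1 := Matrix.fromBlocks_one
  rw [this, map_one]

theorem dsum_map {n m : ℕ} (f : B →⋆ₐ[ℂ] C) (X : Mat B n) (Y : Mat B m) :
    (dsum X Y).map f = dsum (X.map f) (Y.map f) := by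
  refine mat_ext_sum fun i j => ?_
  rw [dsum_apply, CStarMatrix.map_apply, dsum_apply]
  rcases i with i | i <;> rcases j with j | j <;> simp

theorem map_mul' {n : ℕ} (f : B →⋆ₐ[ℂ] C) (X Y : Mat B n) :
    (X * Y).map f = X.map f * Y.map f := by
  ext i j
  simp [CStarMatrix.mul_apply, map_sum]

theorem map_star' {n : ℕ} (f : B →⋆ₐ[ℂ] C) (X : Mat B n) :
    (star X).map f = star (X.map f) := by
  ext i j
  simp [CStarMatrix.star_apply, map_star]

theorem map_one' {n : ℕ} (f : B →⋆ₐ[ℂ] C) : (1 : Mat B n).map f = 1 := by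
  ext i j
  simp only [CStarMatrix.map_apply, CStarMatrix.one_apply]
  split_ifs <;> simp

instance {n : ℕ} : IsTopologicalRing (Mat B n) :=
  inferInstanceAs (IsTopologicalRing (Matrix (Fin n) (Fin n) B))

instance {n : ℕ} : ContinuousStar (Mat B n) :=
  inferInstanceAs (ContinuousStar (Matrix (Fin n) (Fin n) B))

theorem continuous_mat {X : Type*} [TopologicalSpace X] {n : ℕ} {f : X → Mat B n}
    (h : ∀ i j, Continuous fun x => f x i j) : Continuous f :=
  continuous_pi fun i => continuous_pi fun j => h i j

theorem continuous_entry {n : ℕ} (i j : Fin n) : Continuous fun X : Mat B n => X i j :=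
  (continuous_apply j).comp (continuous_apply i)

theorem continuous_dsum {n m : ℕ} :
    Continuous fun p : Mat B n × Mat B m => dsum p.1 p.2 := by
  refine continuous_mat fun i j => ?_
  obtain ⟨i, rfl⟩ := finSumFinEquiv.surjective i
  obtain ⟨j, rfl⟩ := finSumFinEquiv.surjective j
  simp only [dsum_apply]
  rcases i with i | i <;> rcases j with j | j
  · exact (continuous_entry i j).comp continuous_fst
  · exact continuous_const
  · exact continuous_const
  · exact (continuous_entry i j).comp continuous_snd

theorem continuous_reindex {n m : ℕ} (e : Fin n ≃ Fin m) :
    Continuous fun X : Mat B n => CStarMatrix.reindexₐ ℂ B e X :=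
  continuous_mat fun i j => continuous_entry (e.symm i) (e.symm j)

theorem continuous_map {n : ℕ} (f : B →⋆ₐ[ℂ] C) : Continuous fun X : Mat B n => X.map f :=
  continuous_mat fun i j => (map_continuous f).comp (continuous_entry i j)

/-! ### Permuting coordinates does not change the homotopy class -/

theorem joinedIn_swap {n : ℕ} (S : Set (Mat B n))
    (hS : ∀ u ∈ unitary (Mat B n), ∀ X ∈ S, u * X * star u ∈ S) {X : Mat B n} (hX : X ∈ S)
    (x y : Fin n) : JoinedIn S X (CStarMatrix.reindexₐ ℂ B (Equiv.swap x y) X) := by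
  set u : Mat B n := CStarMatrix.ofMatrix ((Equiv.swap x y).permMatrix B) with hu
  have huu : u * u = 1 := by
    have : (Equiv.swap x y).permMatrix B * (Equiv.swap x y).permMatrix B = 1 := by
      rw [← Matrix.permMatrix_mul]; simp
    exact this
  have hus : star u = u := by
    have : ((Equiv.swap x y).permMatrix B).conjTranspose = (Equiv.swap x y).permMatrix B := by
      rw [Matrix.conjTranspose_permMatrix]; simp
    exact this
  set U : ℝ → Mat B n := fun t =>
    ((1 + Complex.exp (Real.pi * t * Complex.I)) / 2) • (1 : Mat B n)
      + ((1 - Complex.exp (Real.pi * t * Complex.I)) / 2) • u with hU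
  have hzz : ∀ t : ℝ, star (Complex.exp (Real.pi * t * Complex.I)) *
      Complex.exp (Real.pi * t * Complex.I) = 1 := by
    intro t
    rw [Complex.star_def, ← Complex.exp_conj, ← Complex.exp_add]
    simp
  have hmem : ∀ t : ℝ, U t ∈ unitary (Mat B n) := by
    intro t
    have h := hzz t
    simp only [hU]
    generalize Complex.exp (Real.pi * t * Complex.I) = z at h
    have h1 : ((1 + star z) / 2) * ((1 + z) / 2) + ((1 - star z) / 2) * ((1 - z) / 2) = 1 := by
      linear_combination h / 2
    have h2 : ((1 + star z) / 2) * ((1 - z) / 2) + ((1 - star z) / 2) * ((1 + z) / 2) = 0 := by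
      linear_combination -h / 2
    have hst : star (((1 + z) / 2) • (1 : Mat B n) + ((1 - z) / 2) • u) =
        ((1 + star z) / 2) • (1 : Mat B n) + ((1 - star z) / 2) • u := by
      rw [star_add, star_smul, star_smul, hus, star_one]
      simp
    rw [Unitary.mem_iff, hst]
    have hmul : ∀ a b c d : ℂ, (a • (1 : Mat B n) + b • u) * (c • (1 : Mat B n) + d • u) =
        (a * c + b * d) • (1 : Mat B n) + (a * d + b * c) • u := by
      intro a b c d
      simp only [add_mul, mul_add, smul_mul_smul_comm, mul_one, one_mul, huu]
      module
    constructor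
    · rw [hmul, h1, h2]; simp
    · rw [hmul, mul_comm _ ((1 + star z) / 2), mul_comm _ ((1 - star z) / 2), h1,
        add_comm, mul_comm ((1 + z) / 2), mul_comm ((1 - z) / 2),
        add_comm (_ * ((1 + z) / 2)), h2]
      simp
  have hcont : Continuous U := by
    refine continuous_mat fun i j => ?_
    simp only [hU, CStarMatrix.add_apply, CStarMatrix.smul_apply]
    fun_prop
  have h0 : U 0 = 1 := by simp [hU]
  have h1 : U 1 = u := by
    simp only [hU, Complex.ofReal_one, mul_one, Complex.exp_pi_mul_I]
    norm_num
  refine JoinedIn.ofLine (f := fun t => U t * X * star (U t)) ?_ ?_ ?_ ?_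
  · exact ((hcont.mul continuous_const).mul hcont.star).continuousOn
  · simp [h0]
  · simp only [h1, hus]
    have hl : (Equiv.swap x y).permMatrix B * CStarMatrix.ofMatrix.symm X *
        (Equiv.swap x y).permMatrix B =
        (CStarMatrix.ofMatrix.symm X).submatrix (Equiv.swap x y) (Equiv.swap x y) := by
      rw [Equiv.Perm.permMatrix, PEquiv.toMatrix_toPEquiv_mul, PEquiv.mul_toMatrix_toPEquiv]
      simp
    have hl' : u * X * u = CStarMatrix.ofMatrix
      ((CStarMatrix.ofMatrix.symm X).submatrix (Equiv.swap x y) (Equiv.swap x y)) := hl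
    rw [hl']
    ext i j
    rw [reindex_apply, Equiv.symm_swap]
    rfl
  · rintro _ ⟨t, -, rfl⟩
    exact hS _ (hmem t) _ hX

theorem reindex_reindex {n m k : ℕ} (e : Fin n ≃ Fin m) (e' : Fin m ≃ Fin k) (X : Mat B n) :
    CStarMatrix.reindexₐ ℂ B e' (CStarMatrix.reindexₐ ℂ B e X) =
      CStarMatrix.reindexₐ ℂ B (e.trans e') X := by
  rfl

theorem reindex_refl {n : ℕ} (X : Mat B n) :
    CStarMatrix.reindexₐ ℂ B (Equiv.refl (Fin n)) X = X := by
  rfl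

theorem joinedIn_perm {n : ℕ} (S : Set (Mat B n))
    (hS : ∀ u ∈ unitary (Mat B n), ∀ X ∈ S, u * X * star u ∈ S) (e : Equiv.Perm (Fin n)) :
    ∀ X ∈ S, JoinedIn S X (CStarMatrix.reindexₐ ℂ B e X) := by
  induction e using Equiv.Perm.swap_induction_on with
  | one =>
    intro X hX
    have : CStarMatrix.reindexₐ ℂ B (1 : Equiv.Perm (Fin n)) X = X := reindex_refl X
    rw [this]
    exact JoinedIn.refl hX
  | swap_mul f x y _ ih =>
    intro X hX
    have h1 := ih X hX
    have h2 := joinedIn_swap S hS h1.target_mem x y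
    rw [reindex_reindex] at h2
    exact h1.trans h2

end Matrices

section Rearrange

variable {B : Type*} [CStarAlgebra B]

theorem dsum_ll {n m : ℕ} (X : Mat B n) (Y : Mat B m) (i j : Fin n) :
    dsum X Y (Fin.castAdd m i) (Fin.castAdd m j) = X i j := dsum_apply X Y (.inl i) (.inl j)

theorem dsum_lr {n m : ℕ} (X : Mat B n) (Y : Mat B m) (i : Fin n) (j : Fin m) :
    dsum X Y (Fin.castAdd m i) (Fin.natAdd n j) = 0 := dsum_apply X Y (.inl i) (.inr j)

theorem dsum_rl {n m : ℕ} (X : Mat B n) (Y : Mat B m) (i : Fin m) (j : Fin n) :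
    dsum X Y (Fin.natAdd n i) (Fin.castAdd m j) = 0 := dsum_apply X Y (.inr i) (.inl j)

theorem dsum_rr {n m : ℕ} (X : Mat B n) (Y : Mat B m) (i j : Fin m) :
    dsum X Y (Fin.natAdd n i) (Fin.natAdd n j) = Y i j := dsum_apply X Y (.inr i) (.inr j)

theorem dsum_comm {n m : ℕ} (X : Mat B n) (Y : Mat B m) :
    ∃ e : Fin (n + m) ≃ Fin (m + n),
      CStarMatrix.reindexₐ ℂ B e (dsum X Y) = dsum Y X := by
  refine ⟨finSumFinEquiv.symm.trans ((Equiv.sumComm _ _).trans finSumFinEquiv), ?_⟩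
  refine mat_ext_sum fun i j => ?_
  rw [reindex_apply]
  rcases i with i | i <;> rcases j with j | j <;>
    simp [dsum_ll, dsum_lr, dsum_rl, dsum_rr]

theorem dsum_assoc {n m k : ℕ} (X : Mat B n) (Y : Mat B m) (Z : Mat B k) :
    ∃ e : Fin (n + m + k) ≃ Fin (n + (m + k)),
      CStarMatrix.reindexₐ ℂ B e (dsum (dsum X Y) Z) = dsum X (dsum Y Z) := by
  refine ⟨finSumFinEquiv.symm.trans (((Equiv.sumCongr finSumFinEquiv.symm (Equiv.refl _)).trans
    ((Equiv.sumAssoc _ _ _).trans (Equiv.sumCongr (Equiv.refl _) finSumFinEquiv))).trans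
    finSumFinEquiv), ?_⟩
  refine mat_ext_sum fun i j => ?_
  rw [reindex_apply]
  rcases i with i | i
  · rcases j with j | j
    · simp [dsum_ll]
    · obtain ⟨j, rfl⟩ := finSumFinEquiv.surjective j
      rcases j with j | j <;> simp [dsum_ll, dsum_lr]
  · obtain ⟨i, rfl⟩ := finSumFinEquiv.surjective i
    rcases j with j | j
    · rcases i with i | i <;> simp [dsum_ll, dsum_rl]
    · obtain ⟨j, rfl⟩ := finSumFinEquiv.surjective j
      rcases i with i | i <;> rcases j with j | j <;>
        simp [dsum_ll, dsum_lr, dsum_rl, dsum_rr]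

theorem dsum_empty {n : ℕ} (X : Mat B n) (Y : Mat B 0) : dsum X Y = X := by
  refine mat_ext_sum fun i j => ?_
  rcases i with i | i
  · rcases j with j | j
    · rw [dsum_apply]; rfl
    · exact j.elim0
  · exact i.elim0

end Rearrange

/-! ### Stable homotopy classes -/

section Stable

variable {B : Type*} [CStarAlgebra B]

/-- `X ∈ S n` and `Y ∈ S m` are homotopic: their sizes agree and they are joined by a continuous
path inside `S m`. -/
def Homotopic (S : ∀ n, Set (Mat B n)) {n m : ℕ} (X : Mat B n) (Y : Mat B m) : Prop :=
  ∃ h : n = m, JoinedIn (S m) (CStarMatrix.reindexₐ ℂ B (finCongr h) X) Y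

/-- Stable homotopy of `X` and `Y` within the sets `S n`, where the stabilizing summands are taken
from the sets `T n`: there are `G ∈ T a` and `G' ∈ T b` with `n + a = m + b` such that `X ⊕ G` and
`Y ⊕ G'` are homotopic. -/
def StablyHomotopic (S T : ∀ n, Set (Mat B n)) {n m : ℕ} (X : Mat B n) (Y : Mat B m) : Prop :=
  ∃ a b : ℕ, ∃ G ∈ T a, ∃ G' ∈ T b, Homotopic S (dsum X G) (dsum Y G')

variable (B) in
/-- Sets `S n` of matrices and sets `T n` of stabilizing matrices for which stable homotopy
classes form a commutative monoid under direct sum. -/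
structure StableSystem where
  /-- the matrices that are classified -/
  S : ∀ n, Set (Mat B n)
  /-- the matrices that may be added in a stabilization -/
  T : ∀ n, Set (Mat B n)
  T_subset : ∀ n, T n ⊆ S n
  conj_mem : ∀ n, ∀ u ∈ unitary (Mat B n), ∀ X ∈ S n, u * X * star u ∈ S n
  dsum_mem : ∀ {n m : ℕ} {X : Mat B n} {Y : Mat B m}, X ∈ S n → Y ∈ S m → dsum X Y ∈ S (n + m)
  dsum_memT : ∀ {n m : ℕ} {X : Mat B n} {Y : Mat B m}, X ∈ T n → Y ∈ T m → dsum X Y ∈ T (n + m)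
  empty_mem : (0 : Mat B 0) ∈ T 0

namespace StableSystem

variable (𝒮 : StableSystem B)

variable {𝒮} in
theorem homotopic_refl {n : ℕ} {X : Mat B n} (hX : X ∈ 𝒮.S n) : Homotopic 𝒮.S X X :=
  ⟨rfl, JoinedIn.refl hX⟩

variable {𝒮} in
theorem homotopic_symm {n m : ℕ} {X : Mat B n} {Y : Mat B m} (h : Homotopic 𝒮.S X Y) :
    Homotopic 𝒮.S Y X := by
  obtain ⟨rfl, h⟩ := h
  exact ⟨rfl, JoinedIn.symm h⟩

variable {𝒮} in
theorem homotopic_trans {n m k : ℕ} {X : Mat B n} {Y : Mat B m} {Z : Mat B k}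
    (h : Homotopic 𝒮.S X Y) (h' : Homotopic 𝒮.S Y Z) : Homotopic 𝒮.S X Z := by
  obtain ⟨rfl, h⟩ := h
  obtain ⟨rfl, h'⟩ := h'
  exact ⟨rfl, JoinedIn.trans h h'⟩

variable {𝒮} in
theorem homotopic_dsum {n m n' m' : ℕ} {X : Mat B n} {Y : Mat B m} {X' : Mat B n'}
    {Y' : Mat B m'} (h : Homotopic 𝒮.S X X') (h' : Homotopic 𝒮.S Y Y') :
    Homotopic 𝒮.S (dsum X Y) (dsum X' Y') := by
  obtain ⟨rfl, h⟩ := h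
  obtain ⟨rfl, h'⟩ := h'
  refine ⟨rfl, ?_⟩
  have h2 := (h.prod h').map (continuous_dsum (B := B) (n := n) (m := m))
  refine h2.mono ?_
  rintro _ ⟨⟨P, Q⟩, ⟨hP, hQ⟩, rfl⟩
  exact 𝒮.dsum_mem hP hQ

variable {𝒮} in
theorem homotopic_reindex {n m : ℕ} {X : Mat B n} (hX : X ∈ 𝒮.S n) (e : Fin n ≃ Fin m) :
    Homotopic 𝒮.S X (CStarMatrix.reindexₐ ℂ B e X) := by
  obtain rfl : n = m := by simpa using Fintype.card_congr e
  exact ⟨rfl, joinedIn_perm _ (𝒮.conj_mem n) e X hX⟩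

variable {𝒮} in
theorem homotopic_comm {n m : ℕ} {X : Mat B n} {Y : Mat B m} (hX : X ∈ 𝒮.S n)
    (hY : Y ∈ 𝒮.S m) : Homotopic 𝒮.S (dsum X Y) (dsum Y X) := by
  obtain ⟨e, he⟩ := dsum_comm X Y
  rw [← he]
  exact homotopic_reindex (𝒮.dsum_mem hX hY) e

variable {𝒮} in
theorem homotopic_assoc {n m k : ℕ} {X : Mat B n} {Y : Mat B m} {Z : Mat B k} (hX : X ∈ 𝒮.S n)
    (hY : Y ∈ 𝒮.S m) (hZ : Z ∈ 𝒮.S k) :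
    Homotopic 𝒮.S (dsum (dsum X Y) Z) (dsum X (dsum Y Z)) := by
  obtain ⟨e, he⟩ := dsum_assoc X Y Z
  rw [← he]
  exact homotopic_reindex (𝒮.dsum_mem (𝒮.dsum_mem hX hY) hZ) e

variable {𝒮} in
theorem homotopic_right_comm {n m k : ℕ} {X : Mat B n} {Y : Mat B m} {Z : Mat B k}
    (hX : X ∈ 𝒮.S n) (hY : Y ∈ 𝒮.S m) (hZ : Z ∈ 𝒮.S k) :
    Homotopic 𝒮.S (dsum (dsum X Y) Z) (dsum (dsum X Z) Y) :=
  homotopic_trans (homotopic_assoc hX hY hZ) (homotopic_trans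
    (homotopic_dsum (homotopic_refl hX) (homotopic_comm hY hZ))
    (homotopic_symm (homotopic_assoc hX hZ hY)))

variable {𝒮} in
theorem stably_of_homotopic {n m : ℕ} {X : Mat B n} {Y : Mat B m}
    (h : Homotopic 𝒮.S X Y) : StablyHomotopic 𝒮.S 𝒮.T X Y :=
  ⟨0, 0, 0, 𝒮.empty_mem, 0, 𝒮.empty_mem, by rw [dsum_empty, dsum_empty]; exact h⟩

variable {𝒮} in
theorem stably_trans {n m k : ℕ} {X : Mat B n} {Y : Mat B m} {Z : Mat B k} (hX : X ∈ 𝒮.S n)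
    (hY : Y ∈ 𝒮.S m) (hZ : Z ∈ 𝒮.S k) (h : StablyHomotopic 𝒮.S 𝒮.T X Y)
    (h' : StablyHomotopic 𝒮.S 𝒮.T Y Z) : StablyHomotopic 𝒮.S 𝒮.T X Z := by
  obtain ⟨a, b, G, hG, G', hG', h⟩ := h
  obtain ⟨c, d, K, hK, K', hK', h'⟩ := h'
  have hGS := 𝒮.T_subset _ hG
  have hGS' := 𝒮.T_subset _ hG'
  have hKS := 𝒮.T_subset _ hK
  have hKS' := 𝒮.T_subset _ hK'
  refine ⟨a + c, d + b, dsum G K, 𝒮.dsum_memT hG hK, dsum K' G', 𝒮.dsum_memT hK' hG', ?_⟩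
  refine homotopic_trans (homotopic_symm (homotopic_assoc hX hGS hKS)) ?_
  refine homotopic_trans (homotopic_dsum h (homotopic_refl hKS)) ?_
  refine homotopic_trans (homotopic_right_comm hY hGS' hKS) ?_
  refine homotopic_trans (homotopic_dsum h' (homotopic_refl hGS')) ?_
  exact homotopic_assoc hZ hKS' hGS'

variable {𝒮} in
theorem stably_dsum {n m n' m' : ℕ} {X : Mat B n} {Y : Mat B m} {X' : Mat B n'}
    {Y' : Mat B m'} (hX : X ∈ 𝒮.S n) (hY : Y ∈ 𝒮.S m) (hX' : X' ∈ 𝒮.S n') (hY' : Y' ∈ 𝒮.S m')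
    (h : StablyHomotopic 𝒮.S 𝒮.T X X') (h' : StablyHomotopic 𝒮.S 𝒮.T Y Y') :
    StablyHomotopic 𝒮.S 𝒮.T (dsum X Y) (dsum X' Y') := by
  obtain ⟨a, b, G, hG, G', hG', h⟩ := h
  obtain ⟨c, d, K, hK, K', hK', h'⟩ := h'
  -- `(P ⊕ Q) ⊕ (M ⊕ N)` is homotopic to `(P ⊕ M) ⊕ (Q ⊕ N)`.
  have key : ∀ {p q r s : ℕ} {P : Mat B p} {Q : Mat B q} {M : Mat B r} {N : Mat B s},
      P ∈ 𝒮.S p → Q ∈ 𝒮.S q → M ∈ 𝒮.S r → N ∈ 𝒮.S s →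
      Homotopic 𝒮.S (dsum (dsum P Q) (dsum M N)) (dsum (dsum P M) (dsum Q N)) := by
    intro p q r s P Q M N hP hQ hM hN
    refine homotopic_trans (homotopic_symm (homotopic_assoc (𝒮.dsum_mem hP hQ) hM hN)) ?_
    refine homotopic_trans (homotopic_dsum (homotopic_right_comm hP hQ hM)
      (homotopic_refl hN)) ?_
    exact homotopic_assoc (𝒮.dsum_mem hP hM) hQ hN
  refine ⟨a + c, b + d, dsum G K, 𝒮.dsum_memT hG hK, dsum G' K', 𝒮.dsum_memT hG' hK', ?_⟩
  refine homotopic_trans (key hX hY (𝒮.T_subset _ hG) (𝒮.T_subset _ hK)) ?_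
  refine homotopic_trans (homotopic_dsum h h') ?_
  exact key hX' (𝒮.T_subset _ hG') hY' (𝒮.T_subset _ hK')

/-- Stable homotopy as an equivalence relation on the disjoint union of the sets `S n`. -/
instance setoid : Setoid (Σ n, 𝒮.S n) where
  r X Y := StablyHomotopic 𝒮.S 𝒮.T X.2.1 Y.2.1
  iseqv :=
    { refl := fun X => stably_of_homotopic (homotopic_refl X.2.2)
      symm := by
        rintro X Y ⟨a, b, G, hG, G', hG', h⟩
        exact ⟨b, a, G', hG', G, hG, homotopic_symm h⟩
      trans := fun {X Y Z} h h' => stably_trans X.2.2 Y.2.2 Z.2.2 h h' }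

/-- The set of stable homotopy classes. -/
def Classes : Type _ := Quotient 𝒮.setoid

/-- The stable homotopy class of a matrix. -/
def cls {n : ℕ} (X : Mat B n) (hX : X ∈ 𝒮.S n) : 𝒮.Classes :=
  Quotient.mk 𝒮.setoid ⟨n, X, hX⟩

variable {𝒮} in
theorem cls_eq_cls {n m : ℕ} {X : Mat B n} {Y : Mat B m} {hX : X ∈ 𝒮.S n} {hY : Y ∈ 𝒮.S m} :
    𝒮.cls X hX = 𝒮.cls Y hY ↔ StablyHomotopic 𝒮.S 𝒮.T X Y :=
  Quotient.eq (r := 𝒮.setoid)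

variable {𝒮} in
theorem ind {p : 𝒮.Classes → Prop} (h : ∀ (n : ℕ) (X : Mat B n) (hX : X ∈ 𝒮.S n), p (𝒮.cls X hX))
    (x : 𝒮.Classes) : p x := by
  induction x using Quotient.inductionOn with
  | h X => exact h X.1 X.2.1 X.2.2

instance : Add 𝒮.Classes where
  add := Quotient.map₂ (fun X Y => ⟨X.1 + Y.1, dsum X.2.1 Y.2.1, 𝒮.dsum_mem X.2.2 Y.2.2⟩)
    fun X X' h Y Y' h' => stably_dsum X.2.2 Y.2.2 X'.2.2 Y'.2.2 h h'

instance : Zero 𝒮.Classes where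
  zero := 𝒮.cls 0 (𝒮.T_subset 0 𝒮.empty_mem)

theorem cls_add_cls {n m : ℕ} {X : Mat B n} {Y : Mat B m} (hX : X ∈ 𝒮.S n) (hY : Y ∈ 𝒮.S m) :
    𝒮.cls X hX + 𝒮.cls Y hY = 𝒮.cls (dsum X Y) (𝒮.dsum_mem hX hY) := rfl

theorem cls_eq_zero {n : ℕ} {X : Mat B n} (hX : X ∈ 𝒮.T n) :
    𝒮.cls X (𝒮.T_subset n hX) = 0 := by
  refine cls_eq_cls.2 ⟨0, n, 0, 𝒮.empty_mem, X, hX, ?_⟩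
  refine homotopic_trans ?_ (homotopic_comm (𝒮.T_subset n hX) (𝒮.T_subset 0 𝒮.empty_mem))
  exact homotopic_refl (𝒮.dsum_mem (𝒮.T_subset n hX) (𝒮.T_subset 0 𝒮.empty_mem))

theorem Classes.add_comm (x y : 𝒮.Classes) : x + y = y + x := by
  induction x using ind with | h n X hX =>
  induction y using ind with | h m Y hY =>
  exact cls_eq_cls.2 (stably_of_homotopic (homotopic_comm hX hY))

theorem Classes.add_zero (x : 𝒮.Classes) : x + 0 = x := by
  induction x using ind with | h n X hX =>
  refine cls_eq_cls.2 ?_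
  rw [dsum_empty]
  exact stably_of_homotopic (homotopic_refl hX)

/-- The commutative monoid of stable homotopy classes, with addition induced by `⊕`. -/
instance : AddCommMonoid 𝒮.Classes where
  add_assoc x y z := by
    induction x using ind with | h n X hX =>
    induction y using ind with | h m Y hY =>
    induction z using ind with | h k Z hZ =>
    exact cls_eq_cls.2 (stably_of_homotopic (homotopic_assoc hX hY hZ))
  add_comm := Classes.add_comm 𝒮
  add_zero := Classes.add_zero 𝒮
  zero_add x := by rw [Classes.add_comm, Classes.add_zero]
  nsmul := nsmulRec

end StableSystem

end Stable

/-! ### The group `K₀` of a unital C*-algebra -/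

section KZero

variable {B C : Type*} [CStarAlgebra B] [CStarAlgebra C]

theorem dsum_zero {n m : ℕ} : dsum (0 : Mat B n) (0 : Mat B m) = 0 := by
  refine mat_ext_sum fun i j => ?_
  rcases i with i | i <;> rcases j with j | j <;>
    simp [dsum_ll, dsum_lr, dsum_rl, dsum_rr]

theorem isStarProjection_dsum {n m : ℕ} {p : Mat B n} {q : Mat B m} (hp : IsStarProjection p)
    (hq : IsStarProjection q) : IsStarProjection (dsum p q) where
  isIdempotentElem := by
    rw [IsIdempotentElem, dsum_mul, hp.isIdempotentElem.eq, hq.isIdempotentElem.eq]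
  isSelfAdjoint := by
    rw [IsSelfAdjoint, dsum_star, hp.isSelfAdjoint.star_eq, hq.isSelfAdjoint.star_eq]

theorem isStarProjection_map {n : ℕ} (f : B →⋆ₐ[ℂ] C) {p : Mat B n} (hp : IsStarProjection p) :
    IsStarProjection (p.map f) where
  isIdempotentElem := by
    rw [IsIdempotentElem, ← map_mul', hp.isIdempotentElem.eq]
  isSelfAdjoint := by
    rw [IsSelfAdjoint, ← map_star', hp.isSelfAdjoint.star_eq]

variable (B) in
/-- Projections in matrices over `B`, stabilized by adding zero matrices. -/
def projSystem : StableSystem B where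
  S _ := {p | IsStarProjection p}
  T _ := {0}
  T_subset n := by
    rintro _ rfl
    exact IsStarProjection.zero _
  conj_mem n u hu p hp := by
    have h1 : star u * u = 1 := (Unitary.mem_iff.1 hu).1
    refine ⟨?_, hp.isSelfAdjoint.conjugate u⟩
    calc u * p * star u * (u * p * star u) = u * (p * (star u * u) * p) * star u := by
          simp only [mul_assoc]
      _ = u * p * star u := by rw [h1, mul_one, hp.isIdempotentElem.eq]
  dsum_mem := isStarProjection_dsum
  dsum_memT := by
    rintro n m _ _ rfl rfl
    exact dsum_zero
  empty_mem := rfl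

variable (B) in
/-- `K₀(B)` for a unital C*-algebra `B`: the Grothendieck group of the monoid of stable homotopy
classes of projections in the matrix algebras `M_n(B)`. -/
abbrev K0 : Type _ := Algebra.GrothendieckAddGroup (projSystem B).Classes

/-- The class `[p] ∈ K₀(B)` of a projection `p ∈ M_n(B)`. -/
def K0.cls {n : ℕ} (p : Mat B n) (hp : IsStarProjection p) : K0 B :=
  Algebra.GrothendieckAddGroup.of ((projSystem B).cls p hp)

/-- The map induced by a unital `*`-homomorphism on stable homotopy classes of projections. -/
def projMap (f : B →⋆ₐ[ℂ] C) : (projSystem B).Classes →+ (projSystem C).Classes where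
  toFun := Quotient.map (fun p => ⟨p.1, p.2.1.map f, isStarProjection_map f p.2.2⟩) (by
    rintro ⟨n, p, hp⟩ ⟨m, q, hq⟩ ⟨a, b, _, rfl, _, rfl, h, h'⟩
    refine ⟨a, b, 0, rfl, 0, rfl, h, ?_⟩
    have h2 := h'.map (continuous_map f)
    have e0 : ∀ {k : ℕ}, (0 : Mat B k).map f = 0 := by
      intro k; ext i j; simp
    have e1 : (CStarMatrix.reindexₐ ℂ B (finCongr h) (dsum p (0 : Mat B a))).map f =
        CStarMatrix.reindexₐ ℂ C (finCongr h) (dsum (p.map f) (0 : Mat C a)) := by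
      rw [← e0, ← dsum_map]
      rfl
    rw [e1, dsum_map, e0] at h2
    refine h2.mono ?_
    rintro _ ⟨r, hr, rfl⟩
    exact isStarProjection_map f hr)
  map_zero' := by
    refine congrArg (Quotient.mk (projSystem C).setoid) ?_
    exact congrArg (Sigma.mk 0) (Subtype.ext (funext fun i => i.elim0))
  map_add' x y := by
    induction x using StableSystem.ind with | h n p hp =>
    induction y using StableSystem.ind with | h m q hq =>
    refine congrArg (Quotient.mk (projSystem C).setoid) ?_
    exact congrArg (Sigma.mk (n + m)) (Subtype.ext (dsum_map f p q))

/-- The homomorphism `K₀(f) : K₀(B) → K₀(C)` induced by a unital `*`-homomorphism `f`. -/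
def K0.map (f : B →⋆ₐ[ℂ] C) : K0 B →+ K0 C :=
  Algebra.GrothendieckAddGroup.lift
    ((Algebra.GrothendieckAddGroup.of (M := (projSystem C).Classes)).comp (projMap f))

theorem K0.map_cls (f : B →⋆ₐ[ℂ] C) {n : ℕ} (p : Mat B n) (hp : IsStarProjection p) :
    K0.map f (K0.cls p hp) = K0.cls (p.map f) (isStarProjection_map f hp) :=
  DFunLike.congr_fun (Algebra.GrothendieckAddGroup.lift.symm_apply_apply
    ((Algebra.GrothendieckAddGroup.of (M := (projSystem C).Classes)).comp (projMap f)))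
    ((projSystem B).cls p hp)

end KZero

/-! ### Spectral projections of selfadjoint invertible matrices -/

section SelfAdjoint

variable {B C : Type*} [CStarAlgebra B] [CStarAlgebra C]

variable (B) in
/-- The selfadjoint invertible elements of `M_n(B)`. -/
def saInv (n : ℕ) : Set (Mat B n) := {H | IsUnit H ∧ IsSelfAdjoint H}

theorem saInv_dsum {n m : ℕ} {X : Mat B n} {Y : Mat B m} (hX : X ∈ saInv B n)
    (hY : Y ∈ saInv B m) : dsum X Y ∈ saInv B (n + m) := by
  obtain ⟨⟨u, rfl⟩, hX⟩ := hX
  obtain ⟨⟨v, rfl⟩, hY⟩ := hY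
  refine ⟨⟨⟨dsum u v, dsum ↑u⁻¹ ↑v⁻¹, ?_, ?_⟩, rfl⟩, ?_⟩
  · rw [dsum_mul]; simp [dsum_one]
  · rw [dsum_mul]; simp [dsum_one]
  · rw [IsSelfAdjoint, dsum_star, hX.star_eq, hY.star_eq]

theorem saInv_map {n : ℕ} (f : B →⋆ₐ[ℂ] C) {X : Mat B n} (hX : X ∈ saInv B n) :
    X.map f ∈ saInv C n := by
  obtain ⟨⟨u, rfl⟩, hX⟩ := hX
  refine ⟨⟨⟨(u : Mat B n).map f, (↑u⁻¹ : Mat B n).map f, ?_, ?_⟩, rfl⟩, ?_⟩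
  · rw [← map_mul']; simp [map_one']
  · rw [← map_mul']; simp [map_one']
  · rw [IsSelfAdjoint, ← map_star', hX.star_eq]

theorem saInv_conj {n : ℕ} {u X : Mat B n} (hu : u ∈ unitary (Mat B n)) (hX : X ∈ saInv B n) :
    u * X * star u ∈ saInv B n := by
  refine ⟨?_, hX.2.conjugate u⟩
  have h := Unitary.mem_iff.1 hu
  have hu1 : IsUnit u := ⟨⟨u, star u, h.2, h.1⟩, rfl⟩
  have hu2 : IsUnit (star u) := ⟨⟨star u, u, h.1, h.2⟩, rfl⟩
  exact (hu1.mul hX.1).mul hu2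

theorem saInv_neg {n : ℕ} {X : Mat B n} (hX : X ∈ saInv B n) : -X ∈ saInv B n :=
  ⟨hX.1.neg, hX.2.neg⟩

theorem saInv_one {n : ℕ} : (1 : Mat B n) ∈ saInv B n := ⟨isUnit_one, .one _⟩

/-- The absolute value `|a| = (a* a)^{1/2}` in a unital C*-algebra, by continuous functional
calculus. -/
def absVal {A : Type*} [CStarAlgebra A] (a : A) : A :=
  letI := CStarAlgebra.spectralOrder A
  letI := CStarAlgebra.spectralOrderedRing A
  CFC.abs a

theorem absVal_spec {A : Type*} [CStarAlgebra A] {a : A} (ha : IsSelfAdjoint a) :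
    absVal a * absVal a = a * a ∧ IsSelfAdjoint (absVal a) ∧ Commute (absVal a) a := by
  let := CStarAlgebra.spectralOrder A
  let := CStarAlgebra.spectralOrderedRing A
  refine ⟨?_, ?_, ?_⟩
  · have := CFC.abs_mul_abs a
    rw [ha.star_eq] at this
    exact this
  · exact (CFC.abs_nonneg a).isSelfAdjoint
  · exact CFC.commute_abs_self a ha.isStarNormal

variable (B) in
/-- The C*-algebra structure on `M_n(B)`. -/
@[reducible] def matCStarAlgebra (n : ℕ) : CStarAlgebra (Mat B n) :=
  letI := CStarAlgebra.spectralOrder B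
  letI := CStarAlgebra.spectralOrderedRing B
  CStarMatrix.instCStarAlgebra

/-- The absolute value `|H|` in the C*-algebra `M_n(B)`. -/
def matAbs {n : ℕ} (H : Mat B n) : Mat B n :=
  letI := matCStarAlgebra B n
  absVal H

theorem matAbs_spec {n : ℕ} {H : Mat B n} (hH : IsSelfAdjoint H) :
    matAbs H * matAbs H = H * H ∧ IsSelfAdjoint (matAbs H) ∧ Commute (matAbs H) H :=
  @absVal_spec _ (matCStarAlgebra B n) H hH

/-- The spectral projection `H₊ = (1 + H |H|⁻¹) / 2` of a selfadjoint invertible matrix `H`. -/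
def posProj {n : ℕ} (H : Mat B n) : Mat B n :=
  (2⁻¹ : ℂ) • (1 + H * Ring.inverse (matAbs H))

theorem isUnit_matAbs {n : ℕ} {H : Mat B n} (hH : H ∈ saInv B n) : IsUnit (matAbs H) := by
  have h : IsUnit (matAbs H * matAbs H) := by
    rw [(matAbs_spec hH.2).1]
    exact hH.1.mul hH.1
  exact ((Commute.refl (matAbs H)).isUnit_mul_iff.1 h).1

theorem isStarProjection_posProj {n : ℕ} {H : Mat B n} (hH : H ∈ saInv B n) :
    IsStarProjection (posProj H) := by
  obtain ⟨h1, h2, h3⟩ := matAbs_spec hH.2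
  obtain ⟨u, hu⟩ := isUnit_matAbs hH
  rw [← hu] at h1 h2 h3
  have hc : Commute (↑u⁻¹ : Mat B n) H := h3.units_inv_left
  have hs : star (↑u⁻¹ : Mat B n) = ↑u⁻¹ := by
    have : star u = u := Units.ext h2
    rw [← Units.coe_star_inv, this]
  have hsq : H * (↑u⁻¹ : Mat B n) * (H * ↑u⁻¹) = 1 := by
    calc H * (↑u⁻¹ : Mat B n) * (H * ↑u⁻¹) = (↑u⁻¹ : Mat B n) * (H * H) * ↑u⁻¹ := by
          rw [← hc.eq]; simp only [mul_assoc]; rw [← hc.eq]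
      _ = 1 := by rw [← h1]; simp
  unfold posProj
  rw [← hu, Ring.inverse_unit]
  set V := H * (↑u⁻¹ : Mat B n)
  have hV : star V = V := by
    rw [star_mul, hs, hH.2.star_eq, hc.eq]
  constructor
  · rw [IsIdempotentElem, smul_mul_smul_comm, mul_add]
    simp only [add_mul, mul_one, one_mul]
    rw [hsq]
    module
  · rw [IsSelfAdjoint, star_smul, star_add, star_one, hV]
    simp

theorem saInv_symmetry {n : ℕ} {p : Mat B n} (hp : IsStarProjection p) :
    (2 : ℂ) • p - 1 ∈ saInv B n := by
  have h : ((2 : ℂ) • p - 1) * ((2 : ℂ) • p - 1) = 1 := by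
    rw [sub_mul, mul_sub, smul_mul_smul_comm, hp.isIdempotentElem.eq]
    simp only [mul_one, one_mul]
    module
  refine ⟨⟨⟨_, _, h, h⟩, rfl⟩, ?_⟩
  rw [IsSelfAdjoint, star_sub, star_smul, hp.isSelfAdjoint.star_eq]
  simp

theorem saInv_symmetry' {n : ℕ} {p : Mat B n} (hp : IsStarProjection p) :
    1 - (2 : ℂ) • p ∈ saInv B n := by
  rw [← neg_sub]
  exact saInv_neg (saInv_symmetry hp)

/-- The matrix exchanging the two summands of `B^n ⊕ B^n`. -/
def exchange (B : Type*) [CStarAlgebra B] (n : ℕ) : Mat B (n + n) :=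
  CStarMatrix.reindexₐ ℂ B finSumFinEquiv (CStarMatrix.ofMatrix
    (Matrix.fromBlocks 0 1 1 0))

theorem exchange_mul_self {n : ℕ} : exchange B n * exchange B n = 1 := by
  unfold exchange
  rw [← map_mul]
  have := Matrix.fromBlocks_multiply (0 : Matrix (Fin n) (Fin n) B)
    (1 : Matrix (Fin n) (Fin n) B) (1 : Matrix (Fin n) (Fin n) B) (0 : Matrix (Fin n) (Fin n) B)
    (0 : Matrix (Fin n) (Fin n) B) (1 : Matrix (Fin n) (Fin n) B) (1 : Matrix (Fin n) (Fin n) B)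
    (0 : Matrix (Fin n) (Fin n) B)
  simp only [Matrix.mul_zero, add_zero, zero_add, mul_one,
    Matrix.fromBlocks_one] at this
  have h2 : (CStarMatrix.ofMatrix (Matrix.fromBlocks 0 1 1 0) :
      CStarMatrix (Fin n ⊕ Fin n) (Fin n ⊕ Fin n) B) *
      CStarMatrix.ofMatrix (Matrix.fromBlocks 0 1 1 0) = 1 := this
  rw [h2, map_one]

theorem exchange_star {n : ℕ} : star (exchange B n) = exchange B n := by
  unfold exchange
  rw [← map_star]
  have := Matrix.fromBlocks_conjTranspose (0 : Matrix (Fin n) (Fin n) B)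
    (1 : Matrix (Fin n) (Fin n) B) (1 : Matrix (Fin n) (Fin n) B) (0 : Matrix (Fin n) (Fin n) B)
  simp only [Matrix.conjTranspose_zero, Matrix.conjTranspose_one] at this
  exact congrArg (CStarMatrix.reindexₐ ℂ B finSumFinEquiv) this

theorem exchange_mul_dsum {n : ℕ} (H : Mat B n) :
    exchange B n * dsum H (-H) = -(dsum H (-H) * exchange B n) := by
  unfold exchange dsum
  rw [← map_mul (CStarMatrix.reindexₐ ℂ B finSumFinEquiv),
    ← map_mul (CStarMatrix.reindexₐ ℂ B finSumFinEquiv), ← map_neg]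
  refine congrArg (CStarMatrix.reindexₐ ℂ B finSumFinEquiv) ?_
  have h1 := Matrix.fromBlocks_multiply (0 : Matrix (Fin n) (Fin n) B) (1 : Matrix (Fin n) (Fin n) B)
    (1 : Matrix (Fin n) (Fin n) B) (0 : Matrix (Fin n) (Fin n) B) (CStarMatrix.ofMatrix.symm H) 0 0 (-CStarMatrix.ofMatrix.symm H)
  have h2 := Matrix.fromBlocks_multiply (CStarMatrix.ofMatrix.symm H) 0 0
    (-CStarMatrix.ofMatrix.symm H) (0 : Matrix (Fin n) (Fin n) B)
    (1 : Matrix (Fin n) (Fin n) B) (1 : Matrix (Fin n) (Fin n) B) (0 : Matrix (Fin n) (Fin n) B)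
  simp only [Matrix.mul_zero, Matrix.zero_mul, add_zero, zero_add, mul_one, one_mul] at h1 h2
  have h3 : Matrix.fromBlocks 0 (-CStarMatrix.ofMatrix.symm H) (CStarMatrix.ofMatrix.symm H) 0 =
      -Matrix.fromBlocks 0 (CStarMatrix.ofMatrix.symm H) (-CStarMatrix.ofMatrix.symm H) 0 := by
    rw [Matrix.fromBlocks_neg]
    simp
  exact h1.trans (h3.trans (congrArg Neg.neg h2.symm))

theorem exchange_mem {n : ℕ} : exchange B n ∈ saInv B (n + n) :=
  ⟨⟨⟨_, _, exchange_mul_self, exchange_mul_self⟩, rfl⟩, exchange_star⟩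

theorem exchange_map {n : ℕ} (f : B →⋆ₐ[ℂ] C) : (exchange B n).map f = exchange C n := by
  refine mat_ext_sum fun i j => ?_
  rw [CStarMatrix.map_apply, exchange, exchange, reindex_apply, reindex_apply, Equiv.symm_apply_apply,
    Equiv.symm_apply_apply, CStarMatrix.ofMatrix_apply, CStarMatrix.ofMatrix_apply]
  rcases i with i | i <;> rcases j with j | j <;> simp [Matrix.one_apply, apply_ite f]

theorem isUnit_sq_add_sq {A : Type*} [CStarAlgebra A] {a : A} (ha : IsSelfAdjoint a)
    (hu : IsUnit a) {c s : ℝ} (h : c ^ 2 + s ^ 2 = 1) :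
    IsUnit (((c : ℂ) ^ 2) • (a * a) + ((s : ℂ) ^ 2) • (1 : A)) := by
  by_cases hs : s = 0
  · subst hs
    have hc : IsUnit ((c : ℂ) ^ 2) := by
      have : c ^ 2 = 1 := by simpa using h
      rw [← Complex.ofReal_pow, this]; simp
    have := (hc.unit • (hu.mul hu).unit).isUnit
    simpa [Units.smul_def] using this
  · have key : ∀ r : ℝ, r ≠ 0 → IsUnit ((c : ℂ) • a + ((r : ℂ) * Complex.I) • (1 : A)) := by
      intro r hr
      have hsa : IsSelfAdjoint ((c : ℂ) • a) := by
        rw [IsSelfAdjoint, star_smul, ha.star_eq]; simp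
      have hn : (-(r : ℂ) * Complex.I) ∉ spectrum ℂ ((c : ℂ) • a) := by
        intro hmem
        have := congrArg Complex.im (hsa.mem_spectrum_eq_re hmem)
        simp at this
        exact hr this
      rw [spectrum.notMem_iff] at hn
      have := hn.neg
      rw [Algebra.algebraMap_eq_smul_one] at this
      convert this using 1
      module
    have h1 := (key s hs).mul (key (-s) (neg_ne_zero.2 hs))
    convert h1 using 1
    simp only [add_mul, mul_add, smul_mul_smul_comm, mul_one, one_mul]
    have e1 : (s : ℂ) * Complex.I * (((-s : ℝ) : ℂ) * Complex.I) = (s : ℂ) ^ 2 := by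
      push_cast
      linear_combination (-(s : ℂ) ^ 2) * Complex.I_sq
    rw [e1]
    push_cast
    module

theorem joinedIn_exchange {n : ℕ} {H : Mat B n} (hH : H ∈ saInv B n) :
    JoinedIn (saInv B (n + n)) (dsum H (-H)) (exchange B n) := by
  have hD := saInv_dsum hH (saInv_neg hH)
  have hanti := exchange_mul_dsum H
  set D := dsum H (-H)
  refine JoinedIn.ofLine (f := fun t : ℝ => ((Real.cos (Real.pi / 2 * t) : ℝ) : ℂ) • D +
    ((Real.sin (Real.pi / 2 * t) : ℝ) : ℂ) • exchange B n) ?_ ?_ ?_ ?_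
  · refine Continuous.continuousOn (continuous_mat fun i j => ?_)
    simp only [CStarMatrix.add_apply, CStarMatrix.smul_apply]
    fun_prop
  · simp
  · simp
  · rintro _ ⟨t, -, rfl⟩
    beta_reduce
    have hcs : Real.cos (Real.pi / 2 * t) ^ 2 + Real.sin (Real.pi / 2 * t) ^ 2 = 1 :=
      Real.cos_sq_add_sin_sq _
    generalize Real.cos (Real.pi / 2 * t) = c at hcs
    generalize Real.sin (Real.pi / 2 * t) = s at hcs
    have hsq : IsUnit (((c : ℂ) ^ 2) • (D * D) + ((s : ℂ) ^ 2) • (1 : Mat B (n + n))) :=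
      @isUnit_sq_add_sq _ (matCStarAlgebra B (n + n)) D hD.2 hD.1 c s hcs
    have hmul : ((c : ℂ) • D + (s : ℂ) • exchange B n) * ((c : ℂ) • D + (s : ℂ) • exchange B n) =
        ((c : ℂ) ^ 2) • (D * D) + ((s : ℂ) ^ 2) • (1 : Mat B (n + n)) := by
      simp only [add_mul, mul_add, smul_mul_smul_comm, hanti, exchange_mul_self]
      module
    rw [← hmul] at hsq
    refine ⟨((Commute.refl _).isUnit_mul_iff.1 hsq).1, ?_⟩
    rw [IsSelfAdjoint, star_add, star_smul, star_smul, hD.2.star_eq, exchange_star]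
    simp

end SelfAdjoint

/-! ### The relative groups of a closed `*`-ideal -/

/-- A norm-closed two-sided `*`-ideal of a unital C*-algebra `L`. -/
structure ClosedStarIdeal (L : Type*) [CStarAlgebra L] extends Submodule ℂ L where
  mul_mem_left : ∀ (x : L) {a : L}, a ∈ carrier → x * a ∈ carrier
  mul_mem_right : ∀ (x : L) {a : L}, a ∈ carrier → a * x ∈ carrier
  star_mem : ∀ {a : L}, a ∈ carrier → star a ∈ carrier
  isClosed : IsClosed carrier

section Relative

variable {L : Type*} [CStarAlgebra L] (A : ClosedStarIdeal L)

/-- The unital C*-subalgebra `D(L, A) = {(x, y) | x - y ∈ A}` of `L ⊕ L`. -/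
def double : StarSubalgebra ℂ (L × L) where
  carrier := {z | z.1 - z.2 ∈ A.toSubmodule}
  mul_mem' {z w} hz hw := by
    have : (z * w).1 - (z * w).2 = z.1 * (w.1 - w.2) + (z.1 - z.2) * w.2 := by
      simp only [Prod.fst_mul, Prod.snd_mul, mul_sub, sub_mul]; abel
    rw [Set.mem_ofPred_eq, this]
    exact A.toSubmodule.add_mem (A.mul_mem_left _ hw) (A.mul_mem_right _ hz)
  add_mem' {z w} hz hw := by
    have : (z + w).1 - (z + w).2 = (z.1 - z.2) + (w.1 - w.2) := by
      simp only [Prod.fst_add, Prod.snd_add]; abel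
    rw [Set.mem_ofPred_eq, this]
    exact A.toSubmodule.add_mem hz hw
  algebraMap_mem' r := by
    rw [Set.mem_ofPred_eq]
    simp
  star_mem' {z} hz := by
    have : (star z).1 - (star z).2 = star (z.1 - z.2) := by simp
    rw [Set.mem_ofPred_eq, this]
    exact A.star_mem hz

instance : IsClosed (double A : Set (L × L)) :=
  A.isClosed.preimage (continuous_fst.sub continuous_snd)

/-- The C*-algebra `D(L, A)`. -/
abbrev Double : Type _ := double A

/-- The unital `*`-homomorphism `ρ₁ : D(L, A) → L`, `(x, y) ↦ x`. -/
def rho1 : Double A →⋆ₐ[ℂ] L := (StarAlgHom.fst ℂ L L).comp (double A).subtype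

/-- The unital `*`-homomorphism `Δ : L → D(L, A)`, `x ↦ (x, x)`. -/
def Delta : L →⋆ₐ[ℂ] Double A :=
  ((StarAlgHom.id ℂ L).prod (StarAlgHom.id ℂ L)).codRestrict (double A) fun x => by
    change x - x ∈ A.toSubmodule
    simp

/-- The relative group `K₀(L, A)`: the kernel of `K₀(ρ₁) : K₀(D(L, A)) → K₀(L)`. -/
def relK0 : AddSubgroup (K0 (Double A)) := (K0.map (rho1 A)).ker

/-- Selfadjoint invertible matrices over `D(L, A)`, stabilized by adding matrices `Δ(G)` with `G` a
selfadjoint invertible matrix over `L`. -/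
def invSystem : StableSystem (Double A) where
  S n := saInv (Double A) n
  T n := (fun G : Mat L n => G.map (Delta A)) '' saInv L n
  T_subset n := by
    rintro _ ⟨G, hG, rfl⟩
    exact saInv_map _ hG
  conj_mem n u hu X hX := saInv_conj hu hX
  dsum_mem := saInv_dsum
  dsum_memT := by
    rintro n m _ _ ⟨G, hG, rfl⟩ ⟨G', hG', rfl⟩
    exact ⟨_, saInv_dsum hG hG', dsum_map _ _ _⟩
  empty_mem := ⟨1, saInv_one, funext fun i => i.elim0⟩

/-- `K₀^inv(L, A)`: stable homotopy classes of selfadjoint invertible matrices over `D(L, A)`. -/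
def K0Inv : Type _ := (invSystem A).Classes

/-- The class `[H]` in `K₀^inv(L, A)` of a selfadjoint invertible matrix over `D(L, A)`. -/
def K0Inv.cls {n : ℕ} (H : Mat (Double A) n) (hH : H ∈ saInv (Double A) n) : K0Inv A :=
  (invSystem A).cls H hH

instance : AddCommMonoid (K0Inv A) := inferInstanceAs (AddCommMonoid (invSystem A).Classes)

instance : Neg (K0Inv A) where
  neg := Quotient.map (fun X => ⟨X.1, -X.2.1, saInv_neg X.2.2⟩) (by
    rintro ⟨n, X, hX⟩ ⟨m, Y, hY⟩ ⟨a, b, _, ⟨G, hG, rfl⟩, _, ⟨G', hG', rfl⟩, h, h'⟩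
    have hneg : ∀ {k l : ℕ} (P : Mat (Double A) k) (Q : Mat L l),
        dsum (-P) ((-Q).map (Delta A)) = -dsum P (Q.map (Delta A)) := by
      intro k l P Q
      refine mat_ext_sum fun i j => ?_
      rcases i with i | i <;> rcases j with j | j <;>
        simp [dsum_ll, dsum_lr, dsum_rl, dsum_rr]
    refine ⟨a, b, _, ⟨-G, saInv_neg hG, rfl⟩, _, ⟨-G', saInv_neg hG', rfl⟩, h, ?_⟩
    have h2 := h'.map (continuous_neg (G := Mat (Double A) (m + b)))
    simp only [hneg]
    rw [map_neg]
    refine h2.mono ?_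
    rintro _ ⟨P, hP, rfl⟩
    exact saInv_neg hP)

/-- The abelian group structure on `K₀^inv(L, A)`, with `[H] + [H'] = [H ⊕ H']` and
`-[H] = [-H]`. -/
instance : AddCommGroup (K0Inv A) where
  __ := (inferInstance : AddCommMonoid (K0Inv A))
  neg_add_cancel x := by
    rw [add_comm]
    induction x using StableSystem.ind with | h n H hH =>
    have h1 : (invSystem A).cls (dsum H (-H)) (saInv_dsum hH (saInv_neg hH)) =
        (invSystem A).cls (exchange (Double A) n) exchange_mem :=
      StableSystem.cls_eq_cls.2 (StableSystem.stably_of_homotopic ⟨rfl, joinedIn_exchange hH⟩)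
    have h2 : (invSystem A).cls (exchange (Double A) n) exchange_mem = 0 :=
      (invSystem A).cls_eq_zero ⟨exchange L n, exchange_mem, exchange_map _⟩
    exact h1.trans h2
  zsmul := zsmulRec

theorem K0Inv.cls_add_cls {n m : ℕ} {H : Mat (Double A) n} {H' : Mat (Double A) m}
    (hH : H ∈ saInv (Double A) n) (hH' : H' ∈ saInv (Double A) m) :
    K0Inv.cls A H hH + K0Inv.cls A H' hH' = K0Inv.cls A (dsum H H') (saInv_dsum hH hH') := rfl

theorem K0Inv.neg_cls {n : ℕ} {H : Mat (Double A) n} (hH : H ∈ saInv (Double A) n) :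
    -K0Inv.cls A H hH = K0Inv.cls A (-H) (saInv_neg hH) := rfl

/-- The neutral element is the class of the unit matrix `E_n`, for any `n`. -/
theorem K0Inv.cls_one (n : ℕ) : K0Inv.cls A (1 : Mat (Double A) n) saInv_one = 0 :=
  (invSystem A).cls_eq_zero ⟨1, saInv_one, map_one' _⟩

end Relative

end RelK

end

/-! Since `ρ₁ ∘ Δ = id`, the map `K₀(ρ₁)` is split by `K₀(Δ)`, and `relProj = id - K₀(Δρ₁)` is a
projection of `K₀(D(L, A))` onto `K₀(L, A)` that kills the image of `K₀(Δ)`. The isomorphism comes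
from the correspondence between selfadjoint invertibles and projections, `H ↦ H₊` and `p ↦ 2p - 1`,
read modulo the image of `Δ` on both sides.

The assignment `H ↦ H₊` is continuous on selfadjoint invertibles, additive for `⊕` and natural in
`*`-homomorphisms (`continuousOn_posProj`, `posProj_dsum`, `posProj_map`). Hence `relProj [H₊]`
depends only on the stable class of `H`: stabilizing by `Δ(G)` adds a class in the image of `K₀(Δ)`.
This gives `spectralDiff`.

In the other direction `[p] ↦ [2p - 1]` is defined on all of `K₀(D(L, A))`, because `K₀^inv` is
already a group and the stabilizing zero projection goes to `-1 = Δ(-1)`, which is trivial. This is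
`symmetryMap`, and it vanishes on the image of `K₀(Δ)`.

The composites are computed from two facts: `(2p - 1)₊ = p` (`posProj_symmetry`), and `H` is joined
to `2H₊ - 1` by a straight line of selfadjoint invertibles (`joinedIn_symmetry_posProj`). So
`symmetryMap ∘ spectralDiff = id`, while `spectralDiff ∘ symmetryMap = relProj`, which is the
identity on `K₀(L, A)`. -/

noncomputable section

namespace RelK

/-! ### Absolute values in a unital C*-algebra -/

section AbsVal

variable {A : Type*} [CStarAlgebra A]

theorem continuous_absVal : Continuous (absVal : A → A) := by
  let := CStarAlgebra.spectralOrder A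
  let := CStarAlgebra.spectralOrderedRing A
  exact CFC.continuous_abs

/-- Records positivity without mentioning an order. The form `star s * s` is visibly preserved by
direct sums and `*`-homomorphisms, so no comparison of spectral orders on different algebras is
needed. -/
theorem absVal_eq_star_mul_self (a : A) : ∃ s : A, absVal a = star s * s := by
  let := CStarAlgebra.spectralOrder A
  let := CStarAlgebra.spectralOrderedRing A
  exact CStarAlgebra.nonneg_iff_eq_star_mul_self.1 (CFC.abs_nonneg a)

/-- Uniqueness of the positive square root; this is how every absolute value below is identified. -/
theorem absVal_unique {a s : A} (ha : IsSelfAdjoint a)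
    (h : star s * s * (star s * s) = a * a) : absVal a = star s * s := by
  let := CStarAlgebra.spectralOrder A
  let := CStarAlgebra.spectralOrderedRing A
  have hs : 0 ≤ star s * s := star_mul_self_nonneg s
  have : CFC.sqrt (star a * a) = star s * s := by
    rw [ha.star_eq]
    exact CFC.sqrt_unique h hs
  exact this

-- For `t > 0` this is a positive element plus a strictly positive scalar. It supplies the
-- invertibility along the line from `H` to `H|H|⁻¹`.
open scoped ComplexOrder in
theorem isUnit_smul_absVal_add {a : A} (ha : IsUnit (absVal a)) {t : ℝ} (h0 : 0 ≤ t)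
    (h1 : t ≤ 1) : IsUnit (((1 - t : ℝ) : ℂ) • absVal a + (t : ℂ) • (1 : A)) := by
  let := CStarAlgebra.spectralOrder A
  let := CStarAlgebra.spectralOrderedRing A
  -- At `t = 0` the scalar term gives no strict positivity, and the invertibility of `absVal a` is
  -- used instead.
  rcases h0.eq_or_lt with rfl | h0
  · simpa using ha
  · have hn : 0 ≤ ((1 - t : ℝ) : ℂ) • absVal a :=
      smul_nonneg (by exact_mod_cast sub_nonneg.2 h1) (CFC.abs_nonneg a)
    have hp : IsStrictlyPositive ((t : ℂ) • (1 : A)) :=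
      IsStrictlyPositive.smul (by exact_mod_cast h0) (IsUnit.isStrictlyPositive isUnit_one zero_le_one)
    exact (hp.nonneg_add hn).isUnit

/-- Inversion is continuous at units of a complete normed ring. An abstract C*-algebra is used here
so that a norm is at hand; for matrices it is supplied explicitly by `matCStarAlgebra`. -/
theorem continuousOn_half_one_add_mul_inverse_absVal :
    ContinuousOn (fun a : A => (2⁻¹ : ℂ) • (1 + a * Ring.inverse (absVal a)))
      {a | IsUnit (absVal a)} := by
  rintro a ⟨u, hu⟩
  have h : ContinuousAt (fun a : A => Ring.inverse (absVal a)) a :=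
    ContinuousAt.comp (hu ▸ NormedRing.inverse_continuousAt u) continuous_absVal.continuousAt
  exact ((continuousAt_const.add (continuousAt_id.mul h)).const_smul _).continuousWithinAt

end AbsVal

/-! ### Spectral projections: continuity, direct sums, naturality -/

section Spectral

variable {B C : Type*} [CStarAlgebra B] [CStarAlgebra C]

theorem matAbs_eq_star_mul_self {n : ℕ} (H : Mat B n) : ∃ S : Mat B n, matAbs H = star S * S :=
  @absVal_eq_star_mul_self _ (matCStarAlgebra B n) H

theorem matAbs_unique {n : ℕ} {H S : Mat B n} (hH : IsSelfAdjoint H)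
    (h : star S * S * (star S * S) = H * H) : matAbs H = star S * S :=
  @absVal_unique _ (matCStarAlgebra B n) H S hH h

theorem continuousOn_posProj {n : ℕ} : ContinuousOn (posProj (B := B)) (saInv B n) :=
  (@continuousOn_half_one_add_mul_inverse_absVal _ (matCStarAlgebra B n)).mono
    fun _ hH => isUnit_matAbs hH

theorem isUnit_smul_matAbs_add {n : ℕ} {H : Mat B n} (hH : H ∈ saInv B n) {t : ℝ} (h0 : 0 ≤ t)
    (h1 : t ≤ 1) : IsUnit (((1 - t : ℝ) : ℂ) • matAbs H + (t : ℂ) • (1 : Mat B n)) :=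
  @isUnit_smul_absVal_add _ (matCStarAlgebra B n) H (isUnit_matAbs hH) t h0 h1

/-- If `|X| = S*S` and `|Y| = T*T`, then `|X| ⊕ |Y| = (S ⊕ T)*(S ⊕ T)` is positive with the right
square, so uniqueness of the root applies. -/
theorem matAbs_dsum {n m : ℕ} {X : Mat B n} {Y : Mat B m} (hX : IsSelfAdjoint X)
    (hY : IsSelfAdjoint Y) : matAbs (dsum X Y) = dsum (matAbs X) (matAbs Y) := by
  obtain ⟨S, hS⟩ := matAbs_eq_star_mul_self X
  obtain ⟨T, hT⟩ := matAbs_eq_star_mul_self Y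
  have e : dsum (matAbs X) (matAbs Y) = star (dsum S T) * dsum S T := by
    rw [dsum_star, dsum_mul, hS, hT]
  rw [e]
  refine matAbs_unique ?_ ?_
  · rw [IsSelfAdjoint, dsum_star, hX.star_eq, hY.star_eq]
  · rw [← e, dsum_mul, dsum_mul, (matAbs_spec hX).1, (matAbs_spec hY).1]

/-- A `*`-homomorphism carries `S*S` to an element of the same form and respects squares, so
uniqueness of the root applies again. -/
theorem matAbs_map {n : ℕ} (f : B →⋆ₐ[ℂ] C) {X : Mat B n} (hX : IsSelfAdjoint X) :
    matAbs (X.map f) = (matAbs X).map f := by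
  obtain ⟨S, hS⟩ := matAbs_eq_star_mul_self X
  have e : (matAbs X).map f = star (S.map f) * S.map f := by
    rw [← map_star', ← map_mul', hS]
  rw [e]
  refine matAbs_unique ?_ ?_
  · rw [IsSelfAdjoint, ← map_star', hX.star_eq]
  · rw [← e, ← map_mul', ← map_mul', (matAbs_spec hX).1]

theorem dsum_add {n m : ℕ} (X X' : Mat B n) (Y Y' : Mat B m) :
    dsum (X + X') (Y + Y') = dsum X Y + dsum X' Y' := by
  refine mat_ext_sum fun i j => ?_
  rcases i with i | i <;> rcases j with j | j <;> simp [dsum_ll, dsum_lr, dsum_rl, dsum_rr]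

theorem dsum_smul {n m : ℕ} (c : ℂ) (X : Mat B n) (Y : Mat B m) :
    dsum (c • X) (c • Y) = c • dsum X Y := by
  refine mat_ext_sum fun i j => ?_
  rcases i with i | i <;> rcases j with j | j <;> simp [dsum_ll, dsum_lr, dsum_rl, dsum_rr]

theorem dsum_neg {n m : ℕ} (X : Mat B n) (Y : Mat B m) : dsum (-X) (-Y) = -dsum X Y := by
  refine mat_ext_sum fun i j => ?_
  rcases i with i | i <;> rcases j with j | j <;> simp [dsum_ll, dsum_lr, dsum_rl, dsum_rr]

theorem map_add' {n : ℕ} (f : B →⋆ₐ[ℂ] C) (X Y : Mat B n) :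
    (X + Y).map f = X.map f + Y.map f := by
  ext i j; simp

theorem map_smul' {n : ℕ} (f : B →⋆ₐ[ℂ] C) (c : ℂ) (X : Mat B n) :
    (c • X).map f = c • X.map f := by
  ext i j; simp

theorem map_neg' {n : ℕ} (f : B →⋆ₐ[ℂ] C) (X : Mat B n) : (-X).map f = -X.map f := by
  ext i j; simp

theorem posProj_dsum {n m : ℕ} {X : Mat B n} {Y : Mat B m} (hX : X ∈ saInv B n)
    (hY : Y ∈ saInv B m) : posProj (dsum X Y) = dsum (posProj X) (posProj Y) := by
  obtain ⟨u, hu⟩ := isUnit_matAbs hX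
  obtain ⟨v, hv⟩ := isUnit_matAbs hY
  have h : Ring.inverse (dsum (u : Mat B n) (v : Mat B m)) =
      dsum (↑u⁻¹ : Mat B n) (↑v⁻¹ : Mat B m) :=
    Ring.inverse_unit (M₀ := Mat B (n + m)) ⟨dsum u v, dsum ↑u⁻¹ ↑v⁻¹,
      by rw [dsum_mul, u.mul_inv, v.mul_inv, dsum_one],
      by rw [dsum_mul, u.inv_mul, v.inv_mul, dsum_one]⟩
  unfold posProj
  rw [matAbs_dsum hX.2 hY.2, ← hu, ← hv, h, Ring.inverse_unit, Ring.inverse_unit, dsum_smul,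
    dsum_add, dsum_mul, dsum_one]

theorem posProj_map {n : ℕ} (f : B →⋆ₐ[ℂ] C) {X : Mat B n} (hX : X ∈ saInv B n) :
    posProj (X.map f) = (posProj X).map f := by
  obtain ⟨u, hu⟩ := isUnit_matAbs hX
  have h : Ring.inverse ((u : Mat B n).map f) = (↑u⁻¹ : Mat B n).map f :=
    Ring.inverse_unit (M₀ := Mat C n) ⟨(u : Mat B n).map f, (↑u⁻¹ : Mat B n).map f,
      by rw [← map_mul', u.mul_inv, map_one'], by rw [← map_mul', u.inv_mul, map_one']⟩
  unfold posProj
  rw [matAbs_map f hX.2, ← hu, h, Ring.inverse_unit, map_smul', map_add', map_mul', map_one']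

/-- The element `2p - 1` squares to `1`, so its absolute value is `1` and the formula for the
spectral projection collapses. -/
theorem posProj_symmetry {n : ℕ} {p : Mat B n} (hp : IsStarProjection p) :
    posProj ((2 : ℂ) • p - 1) = p := by
  have h : ((2 : ℂ) • p - 1) * ((2 : ℂ) • p - 1) = 1 := by
    rw [sub_mul, mul_sub, smul_mul_smul_comm, hp.isIdempotentElem.eq]
    simp only [mul_one, one_mul]
    module
  have habs : matAbs ((2 : ℂ) • p - 1) = 1 := by
    rw [matAbs_unique (S := 1) (saInv_symmetry hp).2 (by rw [h]; simp)]
    simp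
  unfold posProj
  rw [habs, Ring.inverse_one, mul_one]
  module

/-- With `V = 2H₊ - 1 = H|H|⁻¹` one has `H = V|H|`, hence `(1 - t)H + tV = V((1 - t)|H| + t)`, a
product of two invertibles. -/
theorem joinedIn_symmetry_posProj {n : ℕ} {H : Mat B n} (hH : H ∈ saInv B n) :
    JoinedIn (saInv B n) H ((2 : ℂ) • posProj H - 1) := by
  have hunit := @isUnit_smul_matAbs_add _ _ _ _ hH
  have hV := saInv_symmetry (isStarProjection_posProj hH)
  have hmul : ((2 : ℂ) • posProj H - 1) * matAbs H = H := by
    have e : (2 : ℂ) • posProj H - 1 = H * Ring.inverse (matAbs H) := by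
      unfold posProj
      module
    rw [e, mul_assoc, Ring.inverse_mul_cancel _ (isUnit_matAbs hH), mul_one]
  set V := (2 : ℂ) • posProj H - 1
  refine JoinedIn.ofLine
    (f := fun t : ℝ => ((1 - t : ℝ) : ℂ) • H + (t : ℂ) • V) ?_ (by simp) (by simp) ?_
  · refine Continuous.continuousOn (continuous_mat fun i j => ?_)
    simp only [CStarMatrix.add_apply, CStarMatrix.smul_apply]
    fun_prop
  · rintro _ ⟨t, ⟨h0, h1⟩, rfl⟩
    constructor
    · have := hV.1.mul (hunit h0 h1)
      rwa [mul_add, mul_smul_comm, mul_smul_comm, hmul, mul_one] at this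
    · rw [IsSelfAdjoint, star_add, star_smul, star_smul, hH.2.star_eq, hV.2.star_eq]
      simp

end Spectral

/-! ### Transport of homotopies -/

section Stable

variable {B C : Type*} [CStarAlgebra B] [CStarAlgebra C]

/-- A family of maps that are continuous on the sets `S n` preserves homotopy. -/
theorem Homotopic.image {S : ∀ n, Set (Mat B n)} {S' : ∀ n, Set (Mat C n)}
    (F : ∀ k, Mat B k → Mat C k) (hF : ∀ k, ContinuousOn (F k) (S k))
    (hS : ∀ k, Set.MapsTo (F k) (S k) (S' k)) {n m : ℕ} {X : Mat B n} {Y : Mat B m}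
    (h : Homotopic S X Y) : Homotopic S' (F n X) (F m Y) := by
  obtain ⟨rfl, h⟩ := h
  exact ⟨rfl, (h.map_continuousOn (hF _)).mono (Set.mapsTo_iff_image_subset.1 (hS _))⟩

end Stable

/-! ### Classes of spectral projections in `K₀` -/

section SpectralClass

variable {B C : Type*} [CStarAlgebra B] [CStarAlgebra C]

theorem K0.cls_add_cls {n m : ℕ} {p : Mat B n} {q : Mat B m} (hp : IsStarProjection p)
    (hq : IsStarProjection q) :
    K0.cls p hp + K0.cls q hq = K0.cls (dsum p q) (isStarProjection_dsum hp hq) :=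
  (map_add (Algebra.GrothendieckAddGroup.of (M := (projSystem B).Classes)) _ _).symm

theorem K0.cls_congr {n : ℕ} {p q : Mat B n} (h : p = q) (hp : IsStarProjection p)
    (hq : IsStarProjection q) : K0.cls p hp = K0.cls q hq := by
  subst h
  rfl

theorem K0.cls_eq_of_homotopic {n m : ℕ} {p : Mat B n} {q : Mat B m} (hp : IsStarProjection p)
    (hq : IsStarProjection q) (h : Homotopic (projSystem B).S p q) :
    K0.cls p hp = K0.cls q hq :=
  congrArg Algebra.GrothendieckAddGroup.of
    (StableSystem.cls_eq_cls.2 (StableSystem.stably_of_homotopic h))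

/-- The universal property of the Grothendieck group: a homomorphism into a group is determined by
its restriction to the monoid of projection classes. -/
theorem K0.hom_ext {M : Type*} [AddCommGroup M] {f g : K0 B →+ M}
    (h : ∀ (n : ℕ) (p : Mat B n) (hp : IsStarProjection p),
      f (K0.cls p hp) = g (K0.cls p hp)) : f = g := by
  apply Algebra.GrothendieckAddGroup.lift.symm.injective
  ext x
  induction x using StableSystem.ind with | h n p hp =>
  exact h n p hp

/-- The class `[H₊] ∈ K₀(B)` of the spectral projection of a selfadjoint invertible matrix. -/
def spectralCls {n : ℕ} (H : Mat B n) (hH : H ∈ saInv B n) : K0 B :=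
  K0.cls (posProj H) (isStarProjection_posProj hH)

theorem spectralCls_dsum {n m : ℕ} {X : Mat B n} {Y : Mat B m} (hX : X ∈ saInv B n)
    (hY : Y ∈ saInv B m) :
    spectralCls (dsum X Y) (saInv_dsum hX hY) = spectralCls X hX + spectralCls Y hY := by
  unfold spectralCls
  rw [K0.cls_add_cls]
  exact K0.cls_congr (posProj_dsum hX hY) _ _

theorem map_spectralCls (f : B →⋆ₐ[ℂ] C) {n : ℕ} {H : Mat B n} (hH : H ∈ saInv B n) :
    K0.map f (spectralCls H hH) = spectralCls (H.map f) (saInv_map f hH) := by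
  unfold spectralCls
  rw [K0.map_cls]
  exact K0.cls_congr (posProj_map f hH).symm _ _

theorem spectralCls_symmetry {n : ℕ} {p : Mat B n} (hp : IsStarProjection p) :
    spectralCls ((2 : ℂ) • p - 1) (saInv_symmetry hp) = K0.cls p hp :=
  K0.cls_congr (posProj_symmetry hp) _ _

theorem spectralCls_eq_of_homotopic {n m : ℕ} {X : Mat B n} {Y : Mat B m} (hX : X ∈ saInv B n)
    (hY : Y ∈ saInv B m) (h : Homotopic (saInv B) X Y) :
    spectralCls X hX = spectralCls Y hY :=
  K0.cls_eq_of_homotopic _ _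
    (h.image (fun _ => posProj) (fun _ => continuousOn_posProj)
      fun _ _ hH => isStarProjection_posProj hH)

end SpectralClass

/-! ### The splitting of `K₀(ρ₁)` and the projection onto `K₀(L, A)` -/

section Relative

variable {L : Type*} [CStarAlgebra L] (A : ClosedStarIdeal L)

/-- The endomorphism `id - K₀(Δ ρ₁)` of `K₀(D(L, A))`, a projection onto `K₀(L, A)`. -/
def relProj : K0 (Double A) →+ K0 (Double A) :=
  AddMonoidHom.id _ - K0.map ((Delta A).comp (rho1 A))

theorem relProj_apply (x : K0 (Double A)) :
    relProj A x = x - K0.map ((Delta A).comp (rho1 A)) x := rfl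

theorem map_comp_Delta_rho1 (x : K0 (Double A)) :
    K0.map ((Delta A).comp (rho1 A)) x = K0.map (Delta A) (K0.map (rho1 A) x) := by
  refine DFunLike.congr_fun (f := K0.map ((Delta A).comp (rho1 A)))
    (g := (K0.map (Delta A)).comp (K0.map (rho1 A))) (K0.hom_ext fun n p hp => ?_) x
  rw [AddMonoidHom.comp_apply, K0.map_cls, K0.map_cls, K0.map_cls]
  rfl

theorem map_rho1_Delta (x : K0 L) : K0.map (rho1 A) (K0.map (Delta A) x) = x := by
  refine DFunLike.congr_fun (f := (K0.map (rho1 A)).comp (K0.map (Delta A)))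
    (g := AddMonoidHom.id _) (K0.hom_ext fun n p hp => ?_) x
  rw [AddMonoidHom.comp_apply, K0.map_cls, K0.map_cls]
  rfl

theorem relProj_mem (x : K0 (Double A)) : relProj A x ∈ relK0 A := by
  rw [relK0, AddMonoidHom.mem_ker, relProj_apply, map_sub, map_comp_Delta_rho1, map_rho1_Delta,
    sub_self]

theorem relProj_of_mem {x : K0 (Double A)} (hx : x ∈ relK0 A) : relProj A x = x := by
  rw [relK0, AddMonoidHom.mem_ker] at hx
  rw [relProj_apply, map_comp_Delta_rho1, hx, map_zero, sub_zero]

/-- Because `Δρ₁Δ = Δ` holds definitionally, `Δρ₁` fixes the matrix `Δ(G)` and the two terms cancel.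
This makes `spectralDiff` insensitive to stabilization. -/
theorem relProj_spectralCls_Delta {n : ℕ} {G : Mat L n} (hG : G ∈ saInv L n) :
    relProj A (spectralCls (G.map (Delta A)) (saInv_map _ hG)) = 0 := by
  rw [relProj_apply, map_spectralCls, sub_eq_zero]
  rfl

/-- The homomorphism `[H] ↦ [H₊] - [Δρ₁(H₊)]`. -/
def spectralDiff : K0Inv A →+ relK0 A where
  toFun := Quotient.lift
    (fun H => ⟨relProj A (spectralCls H.2.1 H.2.2), relProj_mem A _⟩) (by
    rintro ⟨n, X, hX⟩ ⟨m, Y, hY⟩ ⟨a, b, _, ⟨G, hG, rfl⟩, _, ⟨G', hG', rfl⟩, h⟩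
    -- The stabilized matrices have equal spectral classes; after `relProj` the contributions of
    -- `Δ(G)` and `Δ(G')` disappear.
    have h1 := congrArg (relProj A) (spectralCls_eq_of_homotopic
      (saInv_dsum hX (saInv_map _ hG)) (saInv_dsum hY (saInv_map _ hG')) h)
    rw [spectralCls_dsum hX (saInv_map _ hG), spectralCls_dsum hY (saInv_map _ hG'),
      map_add, map_add, relProj_spectralCls_Delta A hG, relProj_spectralCls_Delta A hG', add_zero,
      add_zero] at h1
    exact Subtype.ext h1)
  map_zero' := by
    -- Zero is represented by the empty matrix, which is itself of the form `Δ(G)`.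
    obtain ⟨G, hG, h⟩ := (invSystem A).empty_mem
    refine Subtype.ext (Eq.trans ?_ (relProj_spectralCls_Delta A hG))
    exact congrArg (relProj A) (K0.cls_congr (congrArg posProj h.symm) _ _)
  map_add' x y := by
    induction x using StableSystem.ind with | h n X hX =>
    induction y using StableSystem.ind with | h m Y hY =>
    refine Subtype.ext ?_
    exact (congrArg (relProj A) (spectralCls_dsum hX hY)).trans (map_add _ _ _)

theorem spectralDiff_cls {n : ℕ} {H : Mat (Double A) n} (hH : H ∈ saInv (Double A) n) :
    (spectralDiff A (K0Inv.cls A H hH) : K0 (Double A)) = relProj A (spectralCls H hH) := rfl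

/-! ### The map `[p] ↦ [2p - 1]` -/

variable {A} in
theorem K0Inv.cls_eq_of_homotopic {n m : ℕ} {X : Mat (Double A) n} {Y : Mat (Double A) m}
    (hX : X ∈ saInv (Double A) n) (hY : Y ∈ saInv (Double A) m)
    (h : Homotopic (saInv (Double A)) X Y) : K0Inv.cls A X hX = K0Inv.cls A Y hY :=
  StableSystem.cls_eq_cls.2 (StableSystem.stably_of_homotopic h)

theorem K0Inv.cls_Delta {n : ℕ} {G : Mat L n} (hG : G ∈ saInv L n) :
    K0Inv.cls A (G.map (Delta A)) (saInv_map _ hG) = 0 :=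
  (invSystem A).cls_eq_zero ⟨G, hG, rfl⟩

theorem K0Inv.cls_congr {n : ℕ} {X Y : Mat (Double A) n} (h : X = Y)
    (hX : X ∈ saInv (Double A) n) (hY : Y ∈ saInv (Double A) n) :
    K0Inv.cls A X hX = K0Inv.cls A Y hY := by
  subst h
  rfl

theorem dsum_symmetry {B : Type*} [CStarAlgebra B] {n m : ℕ} (p : Mat B n) (q : Mat B m) :
    (2 : ℂ) • dsum p q - 1 = dsum ((2 : ℂ) • p - 1) ((2 : ℂ) • q - 1) := by
  rw [sub_eq_add_neg, sub_eq_add_neg, sub_eq_add_neg, dsum_add, dsum_smul, dsum_neg, dsum_one]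

theorem map_symmetry {B C : Type*} [CStarAlgebra B] [CStarAlgebra C] (f : B →⋆ₐ[ℂ] C) {n : ℕ}
    (p : Mat B n) : ((2 : ℂ) • p - 1).map f = (2 : ℂ) • p.map f - 1 := by
  rw [sub_eq_add_neg, sub_eq_add_neg, map_add', map_smul', map_neg', map_one']

theorem K0Inv.cls_symmetry_dsum {n m : ℕ} {p : Mat (Double A) n} {q : Mat (Double A) m}
    (hp : IsStarProjection p) (hq : IsStarProjection q) :
    K0Inv.cls A _ (saInv_symmetry (isStarProjection_dsum hp hq)) =
      K0Inv.cls A _ (saInv_symmetry hp) + K0Inv.cls A _ (saInv_symmetry hq) :=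
  K0Inv.cls_congr A (dsum_symmetry p q) _ (saInv_dsum (saInv_symmetry hp) (saInv_symmetry hq))

/-- Here `2Δ(p) - 1 = Δ(2p - 1)` is one of the stabilizing matrices. -/
theorem K0Inv.cls_symmetry_map_Delta {n : ℕ} {p : Mat L n} (hp : IsStarProjection p) :
    K0Inv.cls A _ (saInv_symmetry (isStarProjection_map (Delta A) hp)) = 0 :=
  (K0Inv.cls_congr A (map_symmetry _ p).symm _ _).trans
    (K0Inv.cls_Delta A (saInv_symmetry hp))

/-- The zero projection is `Δ(0)`. This reconciles the two stabilizations: adding zeros to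
projections corresponds to adding blocks `-1 = Δ(-1)` to selfadjoint invertibles. -/
theorem K0Inv.cls_symmetry_zero (n : ℕ) :
    K0Inv.cls A _ (saInv_symmetry (IsStarProjection.zero (Mat (Double A) n))) = 0 := by
  rw [← K0Inv.cls_symmetry_map_Delta A (IsStarProjection.zero (Mat L n))]
  refine K0Inv.cls_congr A ?_ _ _
  congr 2

/-- The homomorphism `K₀(D(L, A)) → K₀^inv(L, A)`, `[p] ↦ [2p - 1]`. -/
def symmetryMap : K0 (Double A) →+ K0Inv A :=
  -- Since `K₀^inv(L, A)` is a group, a monoid homomorphism on projection classes extends to `K₀`.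
  Algebra.GrothendieckAddGroup.lift
    { toFun := Quotient.lift (fun p => K0Inv.cls A _ (saInv_symmetry p.2.2)) (by
        rintro ⟨n, p, hp⟩ ⟨m, q, hq⟩ ⟨a, b, _, rfl, _, rfl, h⟩
        have h1 : Homotopic (saInv (Double A)) _ _ :=
          h.image (fun _ p => (2 : ℂ) • p - 1) (fun _ => by fun_prop)
            fun _ _ hp => saInv_symmetry hp
        have h2 := K0Inv.cls_eq_of_homotopic
          (saInv_symmetry (isStarProjection_dsum hp (IsStarProjection.zero _)))
          (saInv_symmetry (isStarProjection_dsum hq (IsStarProjection.zero _))) h1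
        rwa [K0Inv.cls_symmetry_dsum A hp (IsStarProjection.zero _),
          K0Inv.cls_symmetry_dsum A hq (IsStarProjection.zero _), K0Inv.cls_symmetry_zero,
          K0Inv.cls_symmetry_zero, add_zero, add_zero] at h2)
      map_zero' := K0Inv.cls_symmetry_zero A 0
      map_add' := by
        intro x y
        induction x using StableSystem.ind with | h n p hp =>
        induction y using StableSystem.ind with | h m q hq =>
        exact K0Inv.cls_symmetry_dsum A hp hq }

theorem symmetryMap_cls {n : ℕ} {p : Mat (Double A) n} (hp : IsStarProjection p) :
    symmetryMap A (K0.cls p hp) = K0Inv.cls A ((2 : ℂ) • p - 1) (saInv_symmetry hp) :=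
  DFunLike.congr_fun (Algebra.GrothendieckAddGroup.lift.symm_apply_apply _)
    ((projSystem (Double A)).cls p hp)

theorem symmetryMap_map_Delta (x : K0 L) : symmetryMap A (K0.map (Delta A) x) = 0 := by
  refine DFunLike.congr_fun (f := (symmetryMap A).comp (K0.map (Delta A))) (g := 0)
    (K0.hom_ext fun n p hp => ?_) x
  rw [AddMonoidHom.comp_apply, K0.map_cls, symmetryMap_cls]
  exact K0Inv.cls_symmetry_map_Delta A hp

/-! ### The two maps are mutually inverse -/

theorem symmetryMap_spectralDiff (x : K0Inv A) :
    symmetryMap A (spectralDiff A x : K0 (Double A)) = x := by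
  induction x using StableSystem.ind with | h n H hH =>
  have h : symmetryMap A (relProj A (spectralCls H hH)) =
      K0Inv.cls A _ (saInv_symmetry (isStarProjection_posProj hH)) := by
    -- The correction term `[Δρ₁(H₊)]` lies in the image of `K₀(Δ)`, which `symmetryMap` kills.
    rw [relProj_apply, map_sub, map_comp_Delta_rho1, symmetryMap_map_Delta, sub_zero]
    exact symmetryMap_cls A _
  exact h.trans (K0Inv.cls_eq_of_homotopic hH _ ⟨rfl, joinedIn_symmetry_posProj hH⟩).symm

/-- Both sides are homomorphisms on all of `K₀(D(L, A))`, so it suffices to check a single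
projection, where `(2p - 1)₊ = p`. Elements of the kernel need not be written as differences. -/
theorem spectralDiff_symmetryMap (x : K0 (Double A)) :
    (spectralDiff A (symmetryMap A x) : K0 (Double A)) = relProj A x := by
  refine DFunLike.congr_fun
    (f := ((relK0 A).subtype.comp (spectralDiff A)).comp (symmetryMap A)) (g := relProj A)
    (K0.hom_ext fun n p hp => ?_) x
  rw [AddMonoidHom.comp_apply, AddMonoidHom.comp_apply, symmetryMap_cls, AddSubgroup.subtype_apply,
    spectralDiff_cls, spectralCls_symmetry]

/-- The isomorphism `K₀^inv(L, A) ≃ K₀(L, A)`, `[H] ↦ [H₊] - [Δρ₁(H₊)]`. -/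
def spectralEquiv : K0Inv A ≃+ relK0 A where
  __ := spectralDiff A
  invFun x := symmetryMap A x
  left_inv := symmetryMap_spectralDiff A
  right_inv x := Subtype.ext ((spectralDiff_symmetryMap A x).trans (relProj_of_mem A x.2))

end Relative

end RelK

end

theorem theoremt {L : Type*} [CStarAlgebra L] (A : RelK.ClosedStarIdeal L) :
    ∃ φ : RelK.K0Inv A ≃+ RelK.relK0 A,
      (∀ (n : ℕ) (H : RelK.Mat (RelK.Double A) n) (hH : H ∈ RelK.saInv (RelK.Double A) n),
        (φ (RelK.K0Inv.cls A H hH) : RelK.K0 (RelK.Double A)) =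
          RelK.K0.cls (RelK.posProj H) (RelK.isStarProjection_posProj hH) -
          RelK.K0.cls ((RelK.posProj H).map ((RelK.Delta A).comp (RelK.rho1 A)))
            (RelK.isStarProjection_map _ (RelK.isStarProjection_posProj hH))) ∧
      (∀ (n m : ℕ) (p : RelK.Mat (RelK.Double A) n) (q : RelK.Mat (RelK.Double A) m)
        (hp : IsStarProjection p) (hq : IsStarProjection q)
        (h : RelK.K0.cls p hp - RelK.K0.cls q hq ∈ RelK.relK0 A),
        φ.symm ⟨RelK.K0.cls p hp - RelK.K0.cls q hq, h⟩ =
          RelK.K0Inv.cls A (RelK.dsum ((2 : ℂ) • p - 1) (1 - (2 : ℂ) • q))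
            (RelK.saInv_dsum (RelK.saInv_symmetry hp) (RelK.saInv_symmetry' hq))) := by
  refine ⟨RelK.spectralEquiv A, fun n H hH => ?_, fun n m p q hp hq h => ?_⟩
  · rw [← RelK.K0.map_cls]
    rfl
  -- The inverse is the restriction of a homomorphism defined on all of `K₀(D(L, A))`, so it may be
  -- applied to `[p]` and `[q]` separately even when neither lies in `K₀(L, A)`.
  · refine (map_sub (RelK.symmetryMap A) _ _).trans ?_
    rw [RelK.symmetryMap_cls, RelK.symmetryMap_cls, sub_eq_add_neg, RelK.K0Inv.neg_cls,
      RelK.K0Inv.cls_add_cls]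
    exact RelK.K0Inv.cls_congr A (by rw [neg_sub]) _ _
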